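/- Alice holds $x\in X$, Bob holds $y\in Y$, and both want to output $f(x,y)$, where $f:X\times Y\to Z$ with $X,Y,Z$ finite and $Z\neq\emptyset$. Let $\mathsf{CC}_f$ be the deterministic noiseless communication complexity of $f$: the least $T$ such that some protocol in which the parties exchange at most $T$ bits over a noiseless channel (Yao's model) makes both parties output $f(x,y)$ on all inputs. In the model $\mathcal{M}_{\mathrm{adp}}$ over a finite channel alphabet $\Sigma$, a (deterministic) protocol has a fixed number $R$ of rounds, called its round complexity. In each round each party either sends a symbol of $\Sigma$ or remains silent (denoted $\emptyset$), as a function of its input and of what it has received in the previous rounds; after round $R$ each party gives an output, a function of its input and of what it has received. An adversary, who knows both inputs and the transcript so far, may in each round replace each party's transmission by any element of $\Sigma\cup\{\emptyset\}$ (thus symbols can be changed, deleted or inserted). The relative noise rate of an execution is the number of corrupted transmissions (those for which the received element of $\Sigma\cup\{\emptyset\}$ differs from the sent one) divided by the number of non-silent transmissions sent; it is $0$ if nothing is corrupted, and $\infty$ if there are corruptions but no non-silent transmission. A protocol for $f$ resists relative noise rate $\rho$ if, for all inputs $x,y$ and every adversary, both parties output $f(x,y)$ whenever the relative noise rate of the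 execution is at most $\rho$. Theorem. For every $\varepsilon>0$ there are a finite alphabet $\Sigma$ and a constant $C$, both depending only on $\varepsilon$, such that for all finite sets $X,Y,Z$ with $Z\ne\emptyset$ and every function $f:X\times Y\to Z$ there is a protocol in the $\mathcal{M}_{\mathrm{adp}}$ model over $\Sigma$ with round complexity at most $C\cdot \mathsf{CC}_f$ that resists relative noise rate $\max(0,1/2-\varepsilon)$. -/

import Mathlib

/-! ### Noiseless two-party communication -/

/-- A deterministic noiseless two-party protocol (a protocol tree in Yao's model) with inputs in
`X` and `Y` and outputs in `Z`. At an inner node the indicated party sends one bit, a function of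
its own input and of the bits exchanged so far (i.e. of the node); `false` leads to the first
subtree and `true` to the second. At a leaf each party gives an output. -/
inductive NoiselessProtocol (X Y Z : Type*) where
  | leaf (outA : X → Z) (outB : Y → Z) : NoiselessProtocol X Y Z
  | alice (bit : X → Bool) (t0 t1 : NoiselessProtocol X Y Z) : NoiselessProtocol X Y Z
  | bob (bit : Y → Bool) (t0 t1 : NoiselessProtocol X Y Z) : NoiselessProtocol X Y Z

namespace NoiselessProtocol

variable {X Y Z : Type*}

/-- The number of bits exchanged in the worst case. -/
def depth : NoiselessProtocol X Y Z → ℕ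
  | leaf _ _ => 0
  | alice _ t0 t1 => max t0.depth t1.depth + 1
  | bob _ t0 t1 => max t0.depth t1.depth + 1

/-- The outputs of Alice and of Bob on inputs `x` and `y`. -/
def outputs (x : X) (y : Y) : NoiselessProtocol X Y Z → Z × Z
  | leaf outA outB => (outA x, outB y)
  | alice bit t0 t1 => bif bit x then t1.outputs x y else t0.outputs x y
  | bob bit t0 t1 => bif bit y then t1.outputs x y else t0.outputs x y

/-- Both parties always output `f x y`. -/
def Computes (P : NoiselessProtocol X Y Z) (f : X → Y → Z) : Prop :=
  ∀ x y, P.outputs x y = (f x y, f x y)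

/-- Every function on finite sets is computed by some noiseless protocol, so that the minimum in
`commComplexity` is over a nonempty set. -/
theorem exists_computes [Finite X] [Finite Y] [Nonempty Z] (f : X → Y → Z) :
    ∃ P : NoiselessProtocol X Y Z, P.Computes f := by
  classical
  obtain ⟨z⟩ := ‹Nonempty Z›
  have := Fintype.ofFinite X
  have := Fintype.ofFinite Y
  have hA : ∀ (t : X → NoiselessProtocol X Y Z) (l : List X),
      ∃ P : NoiselessProtocol X Y Z, ∀ x ∈ l, ∀ y, P.outputs x y = (t x).outputs x y := by
    intro t l
    induction l with
    | nil => exact ⟨leaf (fun _ => z) (fun _ => z), by simp⟩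
    | cons a l ih =>
      obtain ⟨P, hP⟩ := ih
      refine ⟨alice (fun x => decide (x = a)) P (t a), fun x hx y => ?_⟩
      by_cases h : x = a
      · subst h; simp [outputs]
      · simp only [outputs, h, decide_false, cond_false]
        exact hP x (by simpa [h] using hx) y
  have hB : ∀ (t : Y → NoiselessProtocol X Y Z) (l : List Y),
      ∃ P : NoiselessProtocol X Y Z, ∀ y ∈ l, ∀ x, P.outputs x y = (t y).outputs x y := by
    intro t l
    induction l with
    | nil => exact ⟨leaf (fun _ => z) (fun _ => z), by simp⟩
    | cons a l ih =>
      obtain ⟨P, hP⟩ := ih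
      refine ⟨bob (fun y => decide (y = a)) P (t a), fun y hy x => ?_⟩
      by_cases h : y = a
      · subst h; simp [outputs]
      · simp only [outputs, h, decide_false, cond_false]
        exact hP y (by simpa [h] using hy) x
  choose t ht using fun x : X =>
    hB (fun y => leaf (fun _ => f x y) (fun _ => f x y)) (Finset.univ : Finset Y).toList
  obtain ⟨P, hP⟩ := hA t (Finset.univ : Finset X).toList
  refine ⟨P, fun x y => ?_⟩
  rw [hP x (by simp) y, ht x y (by simp) x]
  rfl

end NoiselessProtocol

/-- The (deterministic, noiseless) communication complexity of `f`: the least number of bits that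
a noiseless protocol computing `f` exchanges in the worst case. -/
noncomputable def commComplexity {X Y Z : Type*} (f : X → Y → Z) : ℕ :=
  sInf {T | ∃ P : NoiselessProtocol X Y Z, P.Computes f ∧ P.depth = T}

/-! ### Protocols with an adaptive order of speaking, over a channel controlled by an adversary -/

/-- A protocol with adaptive order of speaking over the channel alphabet `S`. An element of
`Option S` is either a symbol of `S` or `none`, which stands for silence. In each round each party
decides whether to send a symbol or to remain silent, as a function of its own input and of the
list of what it has received in the previous rounds (silence included). After `rounds` rounds both
parties terminate and each gives an output, a function of its input and of what it received. -/
structure AdaptiveProtocol (S X Y Z : Type*) where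
  rounds : ℕ
  sendA : X → List (Option S) → Option S
  sendB : Y → List (Option S) → Option S
  outA : X → List (Option S) → Z
  outB : Y → List (Option S) → Z

/-- What happens on the channel in one round: Alice sends `sentA` and Bob receives `recvB` in its
place; Bob sends `sentB` and Alice receives `recvA` in its place. -/
structure RoundRecord (S : Type*) where
  sentA : Option S
  recvB : Option S
  sentB : Option S
  recvA : Option S

/-- A strategy of the adversary Eve: in each round she applies to Alice's and to Bob's transmission
a map of symbols and silence to symbols and silence, which may depend on both inputs and on the
transcript of all previous rounds. (Eve's random coins are fixed; quantifying over all
strategies covers every outcome of the coins.) -/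
structure Adversary (S X Y : Type*) where
  chA : X → Y → List (RoundRecord S) → Option S → Option S
  chB : X → Y → List (RoundRecord S) → Option S → Option S

namespace AdaptiveProtocol

variable {S X Y Z : Type*}

/-- The transcript of the first `n` rounds, in chronological order. -/
def transcriptUpTo (π : AdaptiveProtocol S X Y Z) (eve : Adversary S X Y) (x : X) (y : Y) :
    ℕ → List (RoundRecord S)
  | 0 => []
  | n + 1 =>
    let h := transcriptUpTo π eve x y n
    let a := π.sendA x (h.map RoundRecord.recvA)
    let b := π.sendB y (h.map RoundRecord.recvB)
    h ++ [{ sentA := a, recvB := eve.chA x y h a, sentB := b, recvA := eve.chB x y h b }]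

/-- The transcript of the whole execution. -/
def transcript (π : AdaptiveProtocol S X Y Z) (eve : Adversary S X Y) (x : X) (y : Y) :
    List (RoundRecord S) :=
  π.transcriptUpTo eve x y π.rounds

/-- Both parties output `f x y` in the given instance. -/
def CorrectOn (π : AdaptiveProtocol S X Y Z) (eve : Adversary S X Y) (f : X → Y → Z)
    (x : X) (y : Y) : Prop :=
  π.outA x ((π.transcript eve x y).map RoundRecord.recvA) = f x y ∧
    π.outB y ((π.transcript eve x y).map RoundRecord.recvB) = f x y

/-- The communication complexity of an instance: the number of transmissions, by either party,
that are not silence. -/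
def instanceCC (π : AdaptiveProtocol S X Y Z) (eve : Adversary S X Y) (x : X) (y : Y) : ℕ :=
  (π.transcript eve x y).countP (fun r => r.sentA.isSome) +
    (π.transcript eve x y).countP (fun r => r.sentB.isSome)

/-- The noise complexity of an instance: the number of corrupted transmissions (changed symbols,
deleted symbols, and symbols inserted where a party was silent), in both directions. -/
def instanceNC [DecidableEq S] (π : AdaptiveProtocol S X Y Z) (eve : Adversary S X Y)
    (x : X) (y : Y) : ℕ :=
  (π.transcript eve x y).countP (fun r => decide (r.recvB ≠ r.sentA)) +
    (π.transcript eve x y).countP (fun r => decide (r.recvA ≠ r.sentB))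

/-- The relative noise rate of an instance. In `ℝ≥0∞` the quotient is `0` if there is no noise, and
`∞` if there is noise but no communication. -/
noncomputable def noiseRate [DecidableEq S] (π : AdaptiveProtocol S X Y Z)
    (eve : Adversary S X Y) (x : X) (y : Y) : ENNReal :=
  (π.instanceNC eve x y : ENNReal) / (π.instanceCC eve x y : ENNReal)

/-- The protocol computes `f` and resists noise rate `ρ`: both parties output `f x y` in every
instance whose relative noise rate is at most `ρ`. -/
def Resists [DecidableEq S] (π : AdaptiveProtocol S X Y Z) (f : X → Y → Z) (ρ : ENNReal) : Prop :=
  ∀ (x : X) (y : Y) (eve : Adversary S X Y), π.noiseRate eve x y ≤ ρ → π.CorrectOn eve f x y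

end AdaptiveProtocol

/-! View a noiseless protocol of depth T as a simultaneous exchange of T bits in each direction.
Each party streams N = WT packets, encodes them with a tree code over `ZMod p`, and sends each code
symbol as one pulse in a block of p rounds. The information lies in the timing, so one channel
symbol suffices, and every execution has exactly 2N transmissions. One corruption can only erase a
block; a substitution needs two, deleting the pulse and inserting another (`symbolCost_le`). With
these prices, misdecoding the last t - j packets costs nearly t - j rather than half of it
(`decode_spec`). A noise rate below 1/2 means a cost below N, so a fraction 1/κ of the times remains
at which both parties know the other's stream (`card_bad_le`).

Packets have constant size, so histories are announced through pointers into the sender's own past.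
An announcement answers a possibly false history, but the answer to that history is correct. Hence
nothing is ever retracted, and the receiver looks up the answers along the true history
(`lookup_sound`). Returning to the true history may need a long program, which is executed W steps
per packet.

The potential of a party is the length of a program to a true history of length n, plus W(T - n). A
packet raises it by at most 1; at a synced time the party that is behind lowers its own by at least
W - 1. The two potentials start at 2WT in total, so `finished_or_hasCost` ends the exchange once W
times the number of synced times exceeds 4N, which W = 4(κ + 1) ensures. -/

namespace AdaptiveCoding

/-! ### Linear tree codes by averaging -/

section TreeCode

variable {F : Type*} [Field F]

/-- The causal convolution of the sequences `a` and `d`. -/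
def conv (a d : ℕ → F) (i : ℕ) : F := ∑ m ∈ Finset.range (i + 1), a m * d (i - m)

theorem conv_congr {a a' d d' : ℕ → F} {i : ℕ} (ha : ∀ m ≤ i, a m = a' m)
    (hd : ∀ m ≤ i, d m = d' m) : conv a d i = conv a' d' i := by
  refine Finset.sum_congr rfl fun m hm => ?_
  rw [ha m (by simpa [Nat.lt_succ_iff] using hm), hd (i - m) (Nat.sub_le _ _)]

theorem conv_sub (a d d' : ℕ → F) (i : ℕ) :
    conv a (fun k => d k - d' k) i = conv a d i - conv a d' i := by
  simp only [conv, mul_sub, Finset.sum_sub_distrib]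

/-- Reduces streams that first differ at `j` to difference strings that are nonzero at 0, the only
ones the distance bound treats. -/
theorem conv_shift {a d : ℕ → F} {j : ℕ} (hd : ∀ k < j, d k = 0) (i : ℕ) :
    conv a d (j + i) = conv a (fun k => d (j + k)) i := by
  unfold conv
  symm
  refine Finset.sum_subset_zero_on_sdiff (Finset.range_mono (by omega)) ?_ ?_
  · intro m hm
    simp only [Finset.mem_sdiff, Finset.mem_range] at hm
    rw [hd _ (by omega), mul_zero]
  · intro m hm
    simp only [Finset.mem_range] at hm
    rw [show j + i - m = j + (i - m) by omega]

theorem conv_update_self (a d : ℕ → F) (k : ℕ) (c : F) :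
    conv (Function.update a k c) d k = c * d 0 + ∑ m ∈ Finset.range k, a m * d (k - m) := by
  unfold conv
  rw [Finset.sum_range_succ, add_comm]
  congr 1
  · simp
  · refine Finset.sum_congr rfl fun m hm => ?_
    rw [Function.update_of_ne (by simp at hm; omega)]

open Classical in
/-- The number of zeros among the first `n` values of the convolution. -/
noncomputable def zeros (a d : ℕ → F) (n : ℕ) : ℕ :=
  ((Finset.range n).filter fun i => conv a d i = 0).card

open Classical in
theorem zeros_congr {a a' d d' : ℕ → F} {n : ℕ} (ha : ∀ m < n, a m = a' m)
    (hd : ∀ m < n, d m = d' m) : zeros a d n = zeros a' d' n := by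
  unfold zeros
  refine congrArg Finset.card (Finset.filter_congr fun i hi => ?_)
  rw [Finset.mem_range] at hi
  rw [conv_congr (fun m hm => ha m (by omega)) (fun m hm => hd m (by omega))]

open Classical in
theorem zeros_succ (a d : ℕ → F) (n : ℕ) :
    zeros a d (n + 1) = zeros a d n + if conv a d n = 0 then 1 else 0 := by
  unfold zeros
  rw [Finset.range_add_one, Finset.filter_insert]
  split_ifs <;> simp

open Classical in
/-- The sequences with values in `D` at the first `n` places and `0` afterwards. -/
noncomputable def strings (D : Finset F) : ℕ → Finset (ℕ → F)
  | 0 => {fun _ => 0}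
  | n + 1 => (strings D n ×ˢ D).image fun q => Function.update q.1 n q.2

open Classical in
theorem truncate_mem_strings {D : Finset F} {d : ℕ → F} (hd : ∀ i, d i ∈ D) (n : ℕ) :
    (fun i => if i < n then d i else 0) ∈ strings D n := by
  induction n with
  | zero => simp [strings]
  | succ n ih =>
    rw [strings, Finset.mem_image]
    refine ⟨(_, d n), Finset.mem_product.2 ⟨ih, hd n⟩, ?_⟩
    funext i
    change Function.update (fun i => if i < n then d i else 0) n (d n) i = _
    rcases lt_trichotomy i n with h | h | h
    · rw [Function.update_of_ne h.ne, if_pos h, if_pos (by omega)]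
    · subst h; rw [Function.update_self, if_pos (by omega)]
    · rw [Function.update_of_ne h.ne', if_neg (by omega), if_neg (by omega)]

variable [Fintype F]

open Classical in
/-- The weight of the string `d`: exponential in the number of zeros of its encoding. -/
noncomputable def weight (a d : ℕ → F) (n : ℕ) : ℕ :=
  if d 0 = 0 then 1 else Fintype.card F ^ zeros a d n

theorem weight_congr {a a' d : ℕ → F} {n : ℕ} (ha : ∀ m < n, a m = a' m) :
    weight a d n = weight a' d n := by
  unfold weight
  rw [zeros_congr ha fun _ _ => rfl]

-- If the string starts with a nonzero entry, the value at place `k` is a nonconstant affine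
-- function of `c`. It vanishes for at most one `c`, so the extra factor `card F` is paid at most
-- once and the mean weight at most doubles.
open Classical in
theorem sum_weight_update_le (a d : ℕ → F) (k : ℕ) (e : F) :
    ∑ c : F, weight (Function.update a k c) (Function.update d k e) (k + 1) ≤
      Fintype.card F * (2 * weight a d k) := by
  have hpos : 0 < Fintype.card F := Fintype.card_pos
  set d' := Function.update d k e with hd'
  by_cases h0 : d' 0 = 0
  · have : 1 ≤ weight a d k := by
      unfold weight; split_ifs
      · rfl
      · exact Nat.one_le_pow _ _ hpos
    simp only [weight, h0, if_true, Finset.sum_const, Finset.card_univ, smul_eq_mul]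
    exact Nat.mul_le_mul_left _ (by unfold weight at this; omega)
  · have hz : Fintype.card F ^ zeros a d k ≤ weight a d k := by
      rcases Nat.eq_zero_or_pos k with rfl | hk
      · simp [weight, zeros]
      · rw [hd', Function.update_of_ne hk.ne] at h0
        simp [weight, h0]
    have hterm : ∀ c : F, weight (Function.update a k c) d' (k + 1) =
        Fintype.card F ^ zeros a d k *
          (if conv (Function.update a k c) d' k = 0 then Fintype.card F else 1) := by
      intro c
      rw [weight, if_neg h0, zeros_succ, pow_add]
      congr 1
      · rw [zeros_congr (a' := a) (d' := d)]
        · intro m hm; rw [Function.update_of_ne hm.ne]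
        · intro m hm; rw [hd', Function.update_of_ne hm.ne]
      · split_ifs <;> simp
    simp only [hterm]
    rw [← Finset.mul_sum]
    have hsum : ∑ c : F, (if conv (Function.update a k c) d' k = 0 then Fintype.card F else 1) ≤
        Fintype.card F * 2 := by
      rw [Finset.sum_ite]
      simp only [Finset.sum_const, smul_eq_mul, mul_one]
      have h1 : (Finset.univ.filter
          fun c : F => conv (Function.update a k c) d' k = 0).card ≤ 1 := by
        rw [Finset.card_le_one]
        intro c hc c' hc'
        simp only [Finset.mem_filter, Finset.mem_univ, true_and, conv_update_self] at hc hc'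
        exact mul_right_cancel₀ h0 (add_right_cancel (hc.trans hc'.symm))
      have h2 := Finset.card_le_univ (Finset.univ.filter
          fun c : F => ¬ conv (Function.update a k c) d' k = 0)
      nlinarith
    calc _ ≤ weight a d k * (Fintype.card F * 2) := Nat.mul_le_mul hz hsum
      _ = _ := by ring

/-- The coefficients are fixed one at a time, each no worse than the mean over `F`. A new
coefficient leaves the weights of shorter strings unchanged, so one sequence serves all lengths. -/
theorem exists_sum_weight_le (D : Finset F) (N : ℕ) :
    ∃ a : ℕ → F, ∀ n ≤ N, ∑ d ∈ strings D n, weight a d n ≤ (2 * D.card) ^ n := by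
  classical
  induction N with
  | zero =>
    refine ⟨fun _ => 0, fun n hn => ?_⟩
    obtain rfl : n = 0 := by omega
    simp [strings, weight]
  | succ N ih =>
    obtain ⟨a, ha⟩ := ih
    obtain ⟨c, -, hc⟩ : ∃ c ∈ (Finset.univ : Finset F),
        ∑ q ∈ strings D N ×ˢ D,
          weight (Function.update a N c) (Function.update q.1 N q.2) (N + 1) ≤
        (2 * D.card) ^ (N + 1) := by
      refine Finset.exists_le_of_sum_le Finset.univ_nonempty ?_
      rw [Finset.sum_comm]
      calc _ ≤ ∑ q ∈ strings D N ×ˢ D, Fintype.card F * (2 * weight a q.1 N) :=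
            Finset.sum_le_sum fun q _ => sum_weight_update_le a q.1 N q.2
        _ = Fintype.card F * (2 * D.card * ∑ d ∈ strings D N, weight a d N) := by
            rw [Finset.sum_product]
            simp only [Finset.sum_const, smul_eq_mul]
            rw [Finset.mul_sum, Finset.mul_sum]
            exact Finset.sum_congr rfl fun _ _ => by ring
        _ ≤ Fintype.card F * (2 * D.card * (2 * D.card) ^ N) := by gcongr; exact ha N le_rfl
        _ = _ := by simp [pow_succ']
    refine ⟨Function.update a N c, fun n hn => ?_⟩
    rcases hn.lt_or_eq with h | rfl
    · refine le_trans (le_of_eq (Finset.sum_congr rfl fun d _ => ?_)) (ha n (by omega))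
      exact weight_congr fun m hm => Function.update_of_ne (by omega) _ _
    · refine le_trans ?_ hc
      rw [strings]
      exact Finset.sum_image_le_of_nonneg fun _ _ => Nat.zero_le _

/-- Existence of linear tree codes of distance `1 - 1 / M`: few places of the encoding of a
nonzero difference string vanish. -/
theorem exists_treeCode (D : Finset F) {M : ℕ} (hF : (2 * D.card) ^ M ≤ Fintype.card F) (N : ℕ) :
    ∃ a : ℕ → F, ∀ n ≤ N, ∀ d : ℕ → F, (∀ i, d i ∈ D) → d 0 ≠ 0 → M * zeros a d n ≤ n := by
  obtain ⟨a, ha⟩ := exists_sum_weight_le D N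
  refine ⟨a, fun n hn d hd h0 => ?_⟩
  have hD : 1 < 2 * D.card := by
    have := Finset.card_pos.2 ⟨_, hd 0⟩
    omega
  rcases Nat.eq_zero_or_pos n with rfl | hpos
  · simp [zeros]
  have h1 := (Finset.single_le_sum (f := fun d => weight a d n) (fun _ _ => Nat.zero_le _)
    (truncate_mem_strings hd n)).trans (ha n hn)
  simp only [weight, hpos, if_true, h0, if_false] at h1
  rw [zeros_congr (a' := a) (d' := d) (fun _ _ => rfl) (fun m hm => by simp [hm])] at h1
  -- A single weight is at most the whole sum, and each zero contributes a factor of at least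
  -- (2|D|)^M.
  refine (Nat.pow_le_pow_iff_right hD).1 ?_
  calc (2 * D.card) ^ (M * zeros a d n) = ((2 * D.card) ^ M) ^ zeros a d n := pow_mul _ _ _
    _ ≤ Fintype.card F ^ zeros a d n := Nat.pow_le_pow_left hF _
    _ ≤ _ := h1

end TreeCode

end AdaptiveCoding

namespace AdaptiveCoding

/-! ### Packet streams with pointers into their past -/

section Streams

/-- The state of a stream of packets: the state before the last packet, the state that the last
packet pointed to, and the list announced by the last packet. -/
inductive Obj
  | root : Obj
  | mk (prev pos : Obj) (path : List (Bool × Bool)) : Obj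

/-- A packet is a program of at most `W` navigation steps, and possibly a pair of bits by which
the list found there is extended. -/
abbrev Packet (W : ℕ) := {l : List Bool // l.length ≤ W} × Option (Bool × Bool)

theorem finite_packet (W : ℕ) : Finite (Packet W) := by
  have : Finite {l : List Bool // l.length ≤ W} := (List.finite_length_le Bool W).to_subtype
  infer_instance

namespace Obj

/-- One navigation step: `false` goes to the previous state, `true` follows the pointer. -/
def step : Obj → Bool → Obj
  | root, _ => root
  | mk p _ _, false => p
  | mk _ q _, true => q

/-- Run a navigation program. -/
def run (o : Obj) (l : List Bool) : Obj := l.foldl step o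

/-- The list announced by the last packet. -/
def path : Obj → List (Bool × Bool)
  | root => []
  | mk _ _ L => L

/-- The list announced by the packet `k`. -/
def extend (c : Obj) : Option (Bool × Bool) → List (Bool × Bool)
  | none => c.path
  | some q => q :: c.path

/-- The state after the packet `k`. -/
def next {W : ℕ} (o : Obj) (k : Packet W) : Obj :=
  mk o (o.run k.1) ((o.run k.1).extend k.2)

theorem path_next {W : ℕ} (o : Obj) (k : Packet W) :
    (o.next k).path = (o.run k.1).extend k.2 := rfl

theorem run_nil (o : Obj) : o.run [] = o := rfl

theorem run_cons (o : Obj) (b : Bool) (l : List Bool) : o.run (b :: l) = (o.step b).run l := rfl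

theorem run_append (o : Obj) (l l' : List Bool) : o.run (l ++ l') = (o.run l).run l' :=
  List.foldl_append

theorem run_root (l : List Bool) : root.run l = root := by
  induction l with
  | nil => rfl
  | cons b l ih => exact ih

end Obj

variable {W : ℕ}

/-- The state after the first `t` packets of the stream `w`. -/
def obj (w : ℕ → Packet W) : ℕ → Obj
  | 0 => .root
  | t + 1 => (obj w t).next (w t)

theorem obj_congr {w w' : ℕ → Packet W} {t : ℕ} (h : ∀ i < t, w i = w' i) :
    obj w t = obj w' t := by
  induction t with
  | zero => rfl
  | succ t ih => rw [obj, obj, ih fun i hi => h i (by omega), h t (by omega)]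

/-- Both kinds of step only move back in time, within the history of the stream. -/
theorem exists_run_obj (w : ℕ → Packet W) (t : ℕ) (l : List Bool) :
    ∃ s ≤ t, (obj w t).run l = obj w s := by
  induction t generalizing l with
  | zero => exact ⟨0, le_rfl, Obj.run_root l⟩
  | succ t ih =>
    rcases l with _ | ⟨b, l⟩
    · exact ⟨t + 1, le_rfl, rfl⟩
    · cases b with
      | false =>
        obtain ⟨s, hs, h⟩ := ih l
        exact ⟨s, by omega, h⟩
      | true =>
        obtain ⟨s, hs, h⟩ := ih ((w t).1 ++ l)
        exact ⟨s, by omega, by rw [← h, Obj.run_append]; rfl⟩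

/-- The stream `w` has announced the list `L` within its first `t` packets. -/
def Announced (w : ℕ → Packet W) (t : ℕ) (L : List (Bool × Bool)) : Prop :=
  ∃ s ≤ t, (obj w s).path = L

theorem Announced.mono {w : ℕ → Packet W} {t t' : ℕ} {L : List (Bool × Bool)}
    (h : Announced w t L) (htt : t ≤ t') : Announced w t' L :=
  let ⟨s, hs, h⟩ := h
  ⟨s, hs.trans htt, h⟩

/-- In the stream `w` all extensions are by bits that are determined by the function `g`. -/
def Honest (g : List (Bool × Bool) → Bool → Bool) (w : ℕ → Packet W) : Prop :=
  ∀ t e a, (w t).2 = some (e, a) → a = g ((obj w t).run (w t).1).path e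

/-- Trace the list back to the packet that added its head: packets without an extension only copy an
earlier list. -/
theorem Honest.path_cons {g : List (Bool × Bool) → Bool → Bool} {w : ℕ → Packet W}
    (hw : Honest g w) {s : ℕ} {e a : Bool} {L : List (Bool × Bool)}
    (h : (obj w s).path = (e, a) :: L) : a = g L e ∧ Announced w s L := by
  induction s using Nat.strong_induction_on with
  | _ s ih =>
    rcases s with _ | s
    · simp [obj, Obj.path] at h
    · obtain ⟨s', hs', hc⟩ := exists_run_obj w s (w s).1
      change Obj.extend ((obj w s).run (w s).1) (w s).2 = _ at h
      rcases hq : (w s).2 with _ | ⟨e', a'⟩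
      · rw [hq, hc] at h
        obtain ⟨h1, h2⟩ := ih s' (by omega) h
        exact ⟨h1, h2.mono (by omega)⟩
      · rw [hq] at h
        simp only [Obj.extend, List.cons.injEq, Prod.mk.injEq] at h
        obtain ⟨⟨rfl, rfl⟩, rfl⟩ := h
        exact ⟨hw s _ _ hq, s', by omega, by rw [hc]⟩

open Classical in
/-- The bit by which the stream `w`, within its first `t` packets, first extends `L` after the
other party's bit `e`. -/
noncomputable def lookup (w : ℕ → Packet W) (t : ℕ) (L : List (Bool × Bool)) (e : Bool) :
    Option Bool :=
  if h : ∃ s, s ≤ t ∧ ∃ a, (obj w s).path = (e, a) :: L then some (Nat.find_spec h).2.choose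
  else none

theorem lookup_eq_some {w : ℕ → Packet W} {t : ℕ} {L : List (Bool × Bool)} {e a : Bool}
    (h : lookup w t L e = some a) : ∃ s ≤ t, (obj w s).path = (e, a) :: L := by
  unfold lookup at h
  split_ifs at h with hs
  rw [Option.some.injEq] at h
  exact ⟨_, (Nat.find_spec hs).1, h ▸ (Nat.find_spec hs).2.choose_spec⟩

theorem lookup_sound {g : List (Bool × Bool) → Bool → Bool} {w w' : ℕ → Packet W}
    (hw : Honest g w) {t : ℕ} (hww : ∀ i < t, w' i = w i) {L : List (Bool × Bool)} {e a : Bool}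
    (h : lookup w' t L e = some a) : a = g L e := by
  obtain ⟨s, hs, hp⟩ := lookup_eq_some h
  rw [obj_congr fun i hi => hww i (by omega)] at hp
  exact (hw.path_cons hp).1

theorem lookup_of_announced {g : List (Bool × Bool) → Bool → Bool} {w w' : ℕ → Packet W}
    (hw : Honest g w) {m t : ℕ} (hmt : m ≤ t) (hww : ∀ i < m, w' i = w i)
    {L : List (Bool × Bool)} {e a : Bool} (h : Announced w m ((e, a) :: L)) :
    lookup w' t L e = some (g L e) := by
  classical
  obtain ⟨s, hs, hp⟩ := h
  have hex : ∃ s, s ≤ t ∧ ∃ a, (obj w' s).path = (e, a) :: L :=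
    ⟨s, hs.trans hmt, a, by rw [obj_congr fun i hi => hww i (by omega), hp]⟩
  -- The first match lies in the agreeing prefix, so wrongly decoded later packets cannot change the
  -- answer.
  have hle : Nat.find hex ≤ m := (Nat.find_min' hex
    ⟨hs.trans hmt, a, by rw [obj_congr fun i hi => hww i (by omega), hp]⟩).trans hs
  unfold lookup
  rw [dif_pos (by convert hex)]
  have hobj : obj w' (Nat.find hex) = obj w (Nat.find hex) :=
    obj_congr fun i hi => hww i (by omega)
  have hp' := (congrArg Obj.path hobj).symm.trans (Nat.find_spec hex).2.choose_spec
  exact congrArg some (hw.path_cons hp').1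

end Streams

/-! ### Simultaneous exchange of bits -/

section Exchange

/-- The state of a simultaneous exchange of bits from the viewpoint of one party. The lists hold,
newest first, the pairs of the bit received before and of the bit sent next, for this party (`own`)
and for the other one (`other`). -/
@[ext]
structure View where
  own : List (Bool × Bool)
  other : List (Bool × Bool)
  ownBit : Bool
  otherBit : Bool

namespace View

/-- The state before the exchange. -/
def init : View := ⟨[], [], false, false⟩

/-- The state after exchanging the bits `a` and `b`. -/
def push (v : View) (a b : Bool) : View :=
  ⟨(v.otherBit, a) :: v.own, (v.ownBit, b) :: v.other, a, b⟩

/-- The same state from the viewpoint of the other party. -/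
def swap (v : View) : View := ⟨v.other, v.own, v.otherBit, v.ownBit⟩

end View

variable (g g' : List (Bool × Bool) → Bool → Bool)

/-- The state after `n` exchanges, from the viewpoint of the party with the function `g`. -/
def truth : ℕ → View
  | 0 => .init
  | n + 1 =>
    (truth n).push (g (truth n).own (truth n).otherBit) (g' (truth n).other (truth n).ownBit)

theorem truth_swap (n : ℕ) : truth g' g n = (truth g g' n).swap := by
  induction n with
  | zero => rfl
  | succ n ih => simp only [truth, ih, View.swap, View.push]

theorem length_truth_own (n : ℕ) : (truth g g' n).own.length = n := by
  induction n with
  | zero => rfl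
  | succ n ih => simp [truth, View.push, ih]

/-- The state after `n` exchanges as far as it is known to the party with the function `g`, given
what it knows about the answers of the other one. -/
def knownView (φ : List (Bool × Bool) → Bool → Option Bool) : ℕ → Option View
  | 0 => some .init
  | n + 1 => (knownView φ n).bind fun v =>
      (φ v.other v.ownBit).map fun b => v.push (g v.own v.otherBit) b

variable {g g'}

theorem knownView_sound {φ : List (Bool × Bool) → Bool → Option Bool}
    (hφ : ∀ L e b, φ L e = some b → b = g' L e) {n : ℕ} {v : View}
    (h : knownView g φ n = some v) : v = truth g g' n := by
  induction n generalizing v with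
  | zero => exact (Option.some.inj h).symm
  | succ n ih =>
    simp only [knownView, Option.bind_eq_some_iff, Option.map_eq_some_iff] at h
    obtain ⟨u, hu, b, hb, rfl⟩ := h
    obtain rfl := ih hu
    obtain rfl := hφ _ _ _ hb
    rfl

theorem knownView_complete {φ : List (Bool × Bool) → Bool → Option Bool} {n : ℕ}
    (hφ : ∀ k < n, φ (truth g g' k).other (truth g g' k).ownBit =
      some (g' (truth g g' k).other (truth g g' k).ownBit)) :
    knownView g φ n = some (truth g g' n) := by
  induction n with
  | zero => rfl
  | succ n ih =>
    rw [knownView, ih fun k hk => hφ k (by omega), Option.bind_some, hφ n (by omega)]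
    rfl

variable {W : ℕ}

theorem announced_truth_of_le {w : ℕ → Packet W} (hw : Honest g w) {t n : ℕ}
    (h : Announced w t (truth g g' n).own) {k : ℕ} (hk : k ≤ n) :
    Announced w t (truth g g' k).own := by
  induction n with
  | zero => obtain rfl : k = 0 := by omega
            exact h
  | succ n ih =>
    rcases hk.eq_or_lt with rfl | hk
    · exact h
    · obtain ⟨s, hs, hp⟩ := h
      exact ih ((hw.path_cons hp).2.mono hs) (by omega)

/-- An honest stream that has announced a list has announced all its tails, so every answer needed
along the way is found. -/
theorem knownView_lookup {w w' : ℕ → Packet W} (hw : Honest g' w) {m t n : ℕ} (hmt : m ≤ t)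
    (hww : ∀ i < m, w' i = w i) (h : Announced w m (truth g' g n).own) :
    knownView g (lookup w' t) n = some (truth g g' n) := by
  refine knownView_complete fun k hk => ?_
  have h1 := announced_truth_of_le hw h (show k + 1 ≤ n from hk)
  rw [truth_swap] at h1
  exact lookup_of_announced hw hmt hww h1

end Exchange

/-! ### Choosing packets and the potential -/

section Navigation

variable {W : ℕ} (T : ℕ) (g g' : List (Bool × Bool) → Bool → Bool)

/-- The pairs of a program and of a bit of the other party that lead to an announcement which
extends the exchange of `T` bits. -/
def candidates (o : Obj) (φ : List (Bool × Bool) → Bool → Option Bool) : Set (List Bool × Bool) :=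
  {q | ∃ n < T, ∃ v, knownView g φ n = some v ∧ (o.run q.1).path = v.own ∧ q.2 = v.otherBit}

variable (W) in
/-- The cost of reaching the end of the exchange by running the program `l` first. -/
def programCost (o : Obj) (l : List Bool) : ℕ := l.length + W * (T - (o.run l).path.length)

open Classical in
variable (W) in
/-- The next packet: it makes progress on a candidate of least cost. -/
noncomputable def choosePacket (o : Obj) (φ : List (Bool × Bool) → Bool → Option Bool) :
    Packet W :=
  if h : (candidates T g o φ).Nonempty then
    let q := Function.argminOn (fun q => programCost W T o q.1) (candidates T g o φ) h
    if hq : q.1.length ≤ W then (⟨q.1, hq⟩, some (q.2, g (o.run q.1).path q.2))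
    else (⟨q.1.take W, by simp⟩, none)
  else (⟨[], by simp⟩, none)

theorem choosePacket_spec {o : Obj} {φ : List (Bool × Bool) → Bool → Option Bool}
    (h : (candidates T g o φ).Nonempty) :
    ∃ q ∈ candidates T g o φ,
      (∀ q' ∈ candidates T g o φ, programCost W T o q.1 ≤ programCost W T o q'.1) ∧
      ((∃ hq : q.1.length ≤ W, choosePacket W T g o φ =
          (⟨q.1, hq⟩, some (q.2, g (o.run q.1).path q.2))) ∨
        W < q.1.length ∧ choosePacket W T g o φ = (⟨q.1.take W, by simp⟩, none)) := by
  refine ⟨Function.argminOn (fun q => programCost W T o q.1) _ h, Function.argminOn_mem _ _ _,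
    fun q' hq' => Function.argminOn_le (fun q => programCost W T o q.1) _ hq', ?_⟩
  rw [choosePacket, dif_pos h]
  by_cases hq : (Function.argminOn (fun q => programCost W T o q.1) _ h).1.length ≤ W
  · exact Or.inl ⟨hq, dif_pos hq⟩
  · exact Or.inr ⟨not_le.1 hq, dif_neg hq⟩

theorem choosePacket_honest {o : Obj} {φ : List (Bool × Bool) → Bool → Option Bool} {e a : Bool}
    (h : (choosePacket W T g o φ).2 = some (e, a)) :
    a = g (o.run (choosePacket W T g o φ).1).path e := by
  by_cases hne : (candidates T g o φ).Nonempty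
  · obtain ⟨q, -, -, ⟨hq, h1⟩ | ⟨-, h1⟩⟩ := choosePacket_spec (W := W) T g hne
    · rw [h1] at h ⊢
      cases h
      rfl
    · rw [h1] at h
      cases h
  · rw [choosePacket, dif_neg hne] at h
    cases h

variable (W) in
/-- From the state `o` the end of the exchange can be reached at cost at most `c`. -/
def HasCost (o : Obj) (c : ℕ) : Prop :=
  ∃ l n, n ≤ T ∧ (o.run l).path = (truth g g' n).own ∧ l.length + W * (T - n) ≤ c

variable {T g g'}

/-- A leading `false` undoes the packet, so a wasted packet costs one step. -/
theorem HasCost.next {o : Obj} {c : ℕ} (h : HasCost W T g g' o c) (k : Packet W) :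
    HasCost W T g g' (o.next k) (c + 1) := by
  obtain ⟨l, n, hn, hp, hc⟩ := h
  exact ⟨false :: l, n, hn, hp, by simp only [List.length_cons]; omega⟩

/-- The chosen candidate is no dearer than `l`. A short program is run and its list extended, which
saves `W`; of a long one, `W` steps are replaced by the single step `true`, which saves `W - 1`. -/
theorem HasCost.choosePacket {o : Obj} {φ : List (Bool × Bool) → Bool → Option Bool}
    (hφ : ∀ L e b, φ L e = some b → b = g' L e) {l : List Bool} {n : ℕ} (hn : n < T)
    (hl : (o.run l).path = (truth g g' n).own) (hk : knownView g φ n = some (truth g g' n)) :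
    ∃ c, HasCost W T g g' (o.next (choosePacket W T g o φ)) c ∧
      c + W ≤ l.length + W * (T - n) + 1 := by
  have hmem : (l, (truth g g' n).otherBit) ∈ candidates T g o φ := ⟨n, hn, _, hk, hl, rfl⟩
  have hne : (candidates T g o φ).Nonempty := ⟨_, hmem⟩
  obtain ⟨q, ⟨n', hn', v, hv, hp, he⟩, hmin, hq⟩ := choosePacket_spec (W := W) T g hne
  have hle := hmin _ hmem
  -- Soundness of `φ` puts every candidate on the true history, whichever one is chosen.
  obtain rfl := knownView_sound hφ hv
  rw [programCost, programCost, hp, hl, length_truth_own, length_truth_own] at hle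
  change _ ≤ l.length + _ at hle
  rcases hq with ⟨hlen, hq⟩ | ⟨hlen, hq⟩
  · refine ⟨W * (T - (n' + 1)), ⟨[], n' + 1, hn', ?_, by simp⟩, ?_⟩
    · rw [hq, Obj.run_nil, Obj.path_next, Obj.extend, hp, he]
      rfl
    · have : W * (T - n') = W * (T - (n' + 1)) + W := by
        rw [← Nat.mul_succ]; congr 1; omega
      omega
  · refine ⟨(q.1.length - W + 1) + W * (T - n'), ⟨true :: q.1.drop W, n', hn'.le, ?_, ?_⟩, ?_⟩
    · rw [hq, Obj.next, Obj.run_cons, Obj.step, ← Obj.run_append, List.take_append_drop, hp]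
    · simp
    · omega

end Navigation

end AdaptiveCoding

namespace AdaptiveCoding

/-! ### Decoding with erasures and substitutions -/

section Decoding

variable {W : ℕ} {F : Type*} [Field F]

/-- The tree encoding of a stream of packets. -/
def encode (a : ℕ → F) (ι : Packet W → F) (w : ℕ → Packet W) (i : ℕ) : F :=
  conv a (fun k => ι (w k)) i

theorem encode_congr {a : ℕ → F} {ι : Packet W → F} {w w' : ℕ → Packet W} {i : ℕ}
    (h : ∀ k ≤ i, w k = w' k) : encode a ι w i = encode a ι w' i :=
  conv_congr (fun _ _ => rfl) fun k hk => by rw [h k hk]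

open Classical in
/-- The cost of turning the symbol `s` into `y`: one for an erasure, two for a substitution. -/
noncomputable def symbolCost (y : Option F) (s : F) : ℕ :=
  if y = some s then 0 else if y = none then 1 else 2

open Classical in
/-- One if the received symbol `y` is a symbol different from `s`. -/
noncomputable def mismatch (y : Option F) (s : F) : ℕ :=
  if y = some s then 0 else if y = none then 0 else 1

instance (W : ℕ) : Inhabited {l : List Bool // l.length ≤ W} := ⟨⟨[], by simp⟩⟩

/-- A stream whose encoding has the fewest mismatches with the first `t` received symbols. -/
noncomputable def decode (a : ℕ → F) (ι : Packet W → F) (y : ℕ → Option F) (t : ℕ) :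
    ℕ → Packet W :=
  Function.argmin fun w : ℕ → Packet W =>
    ∑ i ∈ Finset.range t, mismatch (y i) (encode a ι w i)

theorem decode_congr {a : ℕ → F} {ι : Packet W → F} {y y' : ℕ → Option F} {t : ℕ}
    (h : ∀ i < t, y i = y' i) : decode a ι y t = decode a ι y' t := by
  unfold decode
  congr 1
  funext w
  exact Finset.sum_congr rfl fun i hi => by rw [h i (by simpa using hi)]

/-- The encoding of streams with `a` and `ι` is a tree code of distance `1 - 1 / M` up to
length `N`. -/
def IsTreeCode (a : ℕ → F) (ι : Packet W → F) (M N : ℕ) : Prop :=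
  ∀ n ≤ N, ∀ d : ℕ → F, (∀ i, ∃ u v, d i = ι u - ι v) → d 0 ≠ 0 → M * zeros a d n ≤ n

-- Where the code symbols differ, a substitution can turn a match of `s` into a match of `s'`,
-- shifting the balance of mismatches by two; an erasure shifts it by one. This is the reason for
-- the prices in `symbolCost`.
open Classical in
theorem one_add_mismatch_le (y : Option F) (s s' : F) :
    1 + mismatch y s ≤ (if s' - s = 0 then 1 else 0) + symbolCost y s + mismatch y s' := by
  unfold mismatch symbolCost
  rcases y with _ | z
  · simp
  · by_cases h1 : z = s
    · subst h1
      by_cases h2 : s' = z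
      · simp [h2]
      · simp [sub_eq_zero, h2, Ne.symm h2]
    · simp only [Option.some.injEq, h1, if_false, reduceCtorEq]
      omega

/-- Let `j` be the first wrong packet. From `j` on, the two encodings agree in at most a fraction
1/(κ + 1) of the places. Summing `one_add_mismatch_le`, the mismatches cancel by minimality of the
decoded stream. -/
theorem decode_spec {a : ℕ → F} {ι : Packet W → F} (hι : Function.Injective ι) {κ N : ℕ}
    (hcode : IsTreeCode a ι (κ + 1) N) (w : ℕ → Packet W) (y : ℕ → Option F) {t : ℕ}
    (ht : t ≤ N) :
    ∃ j ≤ t, (∀ i < j, decode a ι y t i = w i) ∧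
      κ * (t - j) ≤ (κ + 1) * ∑ i ∈ Finset.Ico j t, symbolCost (y i) (encode a ι w i) := by
  classical
  by_cases hgood : ∀ i < t, decode a ι y t i = w i
  · exact ⟨t, le_rfl, hgood, by simp⟩
  push Not at hgood
  set w' := decode a ι y t with hw'
  obtain ⟨hj1, hj2⟩ := Nat.find_spec hgood
  set j := Nat.find hgood with hj
  have hagree : ∀ i < j, w' i = w i := by
    intro i hi
    by_contra h
    exact Nat.find_min hgood hi ⟨by omega, h⟩
  refine ⟨j, hj1.le, hagree, ?_⟩
  have hdiff : ∀ i, encode a ι w' (j + i) - encode a ι w (j + i) =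
      conv a (fun k => ι (w' (j + k)) - ι (w (j + k))) i := by
    intro i
    rw [encode, encode, ← conv_sub, conv_shift]
    intro k hk
    rw [hagree k hk, sub_self]
  have hz := hcode (t - j) (by omega) (fun k => ι (w' (j + k)) - ι (w (j + k)))
    (fun k => ⟨_, _, rfl⟩) (by simpa [sub_eq_zero] using fun h => hj2 (hι h))
  have hzsum : ∑ i ∈ Finset.Ico j t,
      (if encode a ι w' i - encode a ι w i = 0 then 1 else 0) =
      zeros a (fun k => ι (w' (j + k)) - ι (w (j + k))) (t - j) := by
    rw [Finset.sum_Ico_eq_sum_range, zeros, Finset.card_filter]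
    exact Finset.sum_congr rfl fun i _ => by rw [hdiff]
  have hmin : ∑ i ∈ Finset.range t, mismatch (y i) (encode a ι w' i) ≤
      ∑ i ∈ Finset.range t, mismatch (y i) (encode a ι w i) :=
    Function.argmin_le (fun w : ℕ → Packet W =>
      ∑ i ∈ Finset.range t, mismatch (y i) (encode a ι w i)) w
  -- Before `j` both streams have the same encoding, so minimality restricts to the places from `j`
  -- on.
  rw [← Finset.sum_range_add_sum_Ico _ hj1.le, ← Finset.sum_range_add_sum_Ico _ hj1.le,
    Finset.sum_congr (g := fun i => mismatch (y i) (encode a ι w i)) rfl fun i hi => by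
      rw [encode_congr fun k hk => hagree k (by simp at hi; omega)]] at hmin
  have hpt := Finset.sum_le_sum fun i (_ : i ∈ Finset.Ico j t) =>
    one_add_mismatch_le (y i) (encode a ι w i) (encode a ι w' i)
  simp only [Finset.sum_add_distrib, Finset.sum_const, Nat.card_Ico, smul_eq_mul, mul_one] at hpt
  rw [hzsum] at hpt
  have hle : t - j ≤ zeros a (fun k => ι (w' (j + k)) - ι (w (j + k))) (t - j) +
      ∑ i ∈ Finset.Ico j t, symbolCost (y i) (encode a ι w i) := by omega
  have := Nat.mul_le_mul_left (κ + 1) hle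
  rw [mul_add] at this
  have h2 : (κ + 1) * (t - j) = κ * (t - j) + (t - j) := by ring
  omega

open Classical in
/-- If every bad time ends an interval of high cost, then there are few bad times. -/
theorem card_bad_le {Bad : ℕ → Prop} {c : ℕ → ℕ} {κ N : ℕ}
    (h : ∀ t ≤ N, Bad t → ∃ j < t, κ * (t - j) ≤ (κ + 1) * ∑ i ∈ Finset.Ico j t, c i) {n : ℕ}
    (hn : n ≤ N) :
    κ * ((Finset.range (n + 1)).filter Bad).card ≤ (κ + 1) * ∑ i ∈ Finset.range n, c i := by
  induction n using Nat.strong_induction_on with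
  | _ n ih =>
    by_cases hb : Bad n
    · obtain ⟨j, hj, hc⟩ := h n hn hb
      have h1 := ih j hj (by omega)
      have h2 : ((Finset.range (n + 1)).filter Bad).card ≤
          ((Finset.range (j + 1)).filter Bad).card + (n - j) := by
        have hsub : (Finset.range (n + 1)).filter Bad ⊆
            (Finset.range (j + 1)).filter Bad ∪ Finset.Ico (j + 1) (n + 1) := by
          intro i
          simp only [Finset.mem_filter, Finset.mem_union, Finset.mem_range, Finset.mem_Ico]
          rintro ⟨hi, hbi⟩
          by_cases hij : i < j + 1
          · exact Or.inl ⟨hij, hbi⟩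
          · exact Or.inr ⟨by omega, hi⟩
        refine (Finset.card_le_card hsub).trans ((Finset.card_union_le _ _).trans ?_)
        simp
      rw [← Finset.sum_range_add_sum_Ico _ hj.le, mul_add]
      calc _ ≤ κ * (((Finset.range (j + 1)).filter Bad).card + (n - j)) :=
            Nat.mul_le_mul_left _ h2
        _ ≤ _ := by rw [mul_add]; omega
    · rw [Finset.range_add_one, Finset.filter_insert, if_neg hb]
      rcases n with _ | n
      · simp
      · refine (ih n (by omega) (by omega)).trans (Nat.mul_le_mul_left _ ?_)
        rw [Finset.sum_range_succ]
        omega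

end Decoding

/-! ### Progress of the simulation under bounded noise -/

section Simulation

variable {W : ℕ} {F : Type*} [Field F] (T : ℕ) (a : ℕ → F) (ι : Packet W → F)
  (g : List (Bool × Bool) → Bool → Bool) (y : ℕ → Option F)

/-- The state of the own stream of the party with the function `g` that receives `y`. -/
noncomputable def ownObj : ℕ → Obj
  | 0 => .root
  | t + 1 => (ownObj t).next (choosePacket W T g (ownObj t) (lookup (decode a ι y t) t))

/-- The stream of packets sent by the party with the function `g` that receives `y`. -/
noncomputable def ownStream (t : ℕ) : Packet W :=
  choosePacket W T g (ownObj T a ι g y t) (lookup (decode a ι y t) t)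

theorem obj_ownStream (t : ℕ) : obj (ownStream T a ι g y) t = ownObj T a ι g y t := by
  induction t with
  | zero => rfl
  | succ t ih => rw [obj, ih]; rfl

theorem ownStream_eq (t : ℕ) : ownStream T a ι g y t =
    choosePacket W T g (obj (ownStream T a ι g y) t) (lookup (decode a ι y t) t) := by
  rw [obj_ownStream]; rfl

theorem ownStream_honest : Honest g (ownStream T a ι g y) := by
  intro t e b h
  rw [ownStream_eq] at h
  rw [choosePacket_honest T g h, ← ownStream_eq]

theorem ownStream_congr {y y' : ℕ → Option F} {t : ℕ} (h : ∀ i < t, y i = y' i) :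
    ownStream T a ι g y t = ownStream T a ι g y' t := by
  have hobj : ∀ s ≤ t, ownObj T a ι g y s = ownObj T a ι g y' s := by
    intro s hs
    induction s with
    | zero => rfl
    | succ s ih =>
      rw [ownObj, ownObj, ih (by omega), decode_congr fun i hi => h i (by omega)]
  rw [ownStream, ownStream, hobj t le_rfl, decode_congr h]

variable (g' : List (Bool × Bool) → Bool → Bool) (y' : ℕ → Option F)

/-- Both parties know at time `t` what the other one has sent so far. -/
def Synced (t : ℕ) : Prop :=
  (∀ i < t, decode a ι y t i = ownStream T a ι g' y' i) ∧
    ∀ i < t, decode a ι y' t i = ownStream T a ι g y i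

-- Potential argument: a step raises the two costs by at most 2 in total, and a synced step before
-- the end also saves `W`.
open Classical in
theorem finished_or_hasCost (t : ℕ) :
    (Announced (ownStream T a ι g y) t (truth g g' T).own ∧
      Announced (ownStream T a ι g' y') t (truth g' g T).own) ∨
    ∃ c c', HasCost W T g g' (obj (ownStream T a ι g y) t) c ∧
      HasCost W T g' g (obj (ownStream T a ι g' y') t) c' ∧
      c + c' + W * ((Finset.range t).filter (Synced T a ι g y g' y')).card ≤
        2 * (W * T) + 2 * t := by
  have hon := ownStream_honest T a ι g y
  have hon' := ownStream_honest T a ι g' y'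
  induction t with
  | zero =>
    refine Or.inr ⟨W * T, W * T, ⟨[], 0, Nat.zero_le _, rfl, by simp⟩,
      ⟨[], 0, Nat.zero_le _, rfl, by simp⟩, ?_⟩
    simp only [Finset.range_zero, Finset.filter_empty, Finset.card_empty]
    omega
  | succ t ih =>
    rcases ih with ⟨h1, h2⟩ | ⟨c, c', hc, hc', hle⟩
    · exact Or.inl ⟨h1.mono (Nat.le_succ t), h2.mono (Nat.le_succ t)⟩
    rw [Finset.range_add_one, Finset.filter_insert]
    by_cases hs : Synced T a ι g y g' y' t
    · rw [if_pos hs, Finset.card_insert_of_notMem (by simp), mul_add, mul_one]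
      have hnext := hc.next (ownStream T a ι g y t)
      have hnext' := hc'.next (ownStream T a ι g' y' t)
      obtain ⟨l, n, hn, hp, hln⟩ := hc
      obtain ⟨l', n', hn', hp', hln'⟩ := hc'
      have han : Announced (ownStream T a ι g y) t (truth g g' n).own := by
        obtain ⟨s, hs, hr⟩ := exists_run_obj (ownStream T a ι g y) t l
        exact ⟨s, hs, by rw [← hr, hp]⟩
      have han' : Announced (ownStream T a ι g' y') t (truth g' g n').own := by
        obtain ⟨s, hs, hr⟩ := exists_run_obj (ownStream T a ι g' y') t l'
        exact ⟨s, hs, by rw [← hr, hp']⟩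
      -- The party that is behind makes progress, as the other has already announced all answers it
      -- needs.
      rcases le_or_gt n n' with hnn | hnn
      · rcases hn.eq_or_lt with rfl | hlt
        · obtain rfl : n' = n := by omega
          exact Or.inl ⟨han.mono (Nat.le_succ t), han'.mono (Nat.le_succ t)⟩
        · obtain ⟨d, hd, hdc⟩ := HasCost.choosePacket (W := W)
            (φ := lookup (decode a ι y t) t) (fun L e b => lookup_sound hon' hs.1) hlt hp
            (knownView_lookup hon' le_rfl hs.1 (announced_truth_of_le hon' han' hnn))
          rw [← ownStream_eq] at hd
          exact Or.inr ⟨d, c' + 1, hd, hnext', by omega⟩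
      · obtain ⟨d, hd, hdc⟩ := HasCost.choosePacket (W := W)
          (φ := lookup (decode a ι y' t) t) (fun L e b => lookup_sound hon hs.2)
          (show n' < T by omega) hp'
          (knownView_lookup hon le_rfl hs.2 (announced_truth_of_le hon han hnn.le))
        rw [← ownStream_eq] at hd
        exact Or.inr ⟨c + 1, d, hnext, hd, by omega⟩
    · rw [if_neg hs]
      exact Or.inr ⟨c + 1, c' + 1, hc.next _, hc'.next _, by omega⟩

/-- If the noise is bounded, then the party that receives `y` knows all bits of the exchange
after `4 (κ + 1) T` symbols. -/
theorem knownView_of_cost_le {κ : ℕ} (hW : W = 4 * (κ + 1)) (hι : Function.Injective ι)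
    (hcode : IsTreeCode a ι (κ + 1) (W * T))
    (hcost : (κ + 1) * (∑ i ∈ Finset.range (W * T),
        (symbolCost (y' i) (encode a ι (ownStream T a ι g y) i) +
          symbolCost (y i) (encode a ι (ownStream T a ι g' y') i))) + W * T ≤ κ * (W * T)) :
    knownView g (lookup (decode a ι y (W * T)) (W * T)) T = some (truth g g' T) := by
  classical
  set N := W * T with hN
  set c : ℕ → ℕ := fun i => symbolCost (y' i) (encode a ι (ownStream T a ι g y) i) with hc
  set c' : ℕ → ℕ := fun i => symbolCost (y i) (encode a ι (ownStream T a ι g' y') i) with hc'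
  have hdec := fun {t} (ht : t ≤ N) => decode_spec hι hcode (ownStream T a ι g y) y' ht
  have hdec' := fun {t} (ht : t ≤ N) => decode_spec hι hcode (ownStream T a ι g' y') y ht
  obtain ⟨j, hj, hagree, hjc⟩ := hdec le_rfl
  obtain ⟨j', hj', hagree', hjc'⟩ := hdec' le_rfl
  change _ ≤ (κ + 1) * ∑ i ∈ Finset.Ico j N, c i at hjc
  change _ ≤ (κ + 1) * ∑ i ∈ Finset.Ico j' N, c' i at hjc'
  -- Only the first `m` packets are decoded correctly by both in the end, so the exchange must be
  -- complete by time `m`.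
  set m := min j j' with hm
  have hmN : m ≤ N := (min_le_left _ _).trans hj
  have htail : κ * (N - m) ≤ (κ + 1) * ∑ i ∈ Finset.Ico m N, (c i + c' i) := by
    rcases le_total j j' with h | h
    · rw [hm, min_eq_left h]
      exact hjc.trans (Nat.mul_le_mul_left _ (Finset.sum_le_sum fun i _ => Nat.le_add_right _ _))
    · rw [hm, min_eq_right h]
      exact hjc'.trans (Nat.mul_le_mul_left _ (Finset.sum_le_sum fun i _ => Nat.le_add_left _ _))
  obtain ⟨P, hP⟩ : ∃ P : ℕ → Prop,
      ∀ t, P t ↔ ¬ ∀ i < t, decode a ι y' t i = ownStream T a ι g y i := ⟨_, fun _ => Iff.rfl⟩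
  obtain ⟨P', hP'⟩ : ∃ P' : ℕ → Prop,
      ∀ t, P' t ↔ ¬ ∀ i < t, decode a ι y t i = ownStream T a ι g' y' i := ⟨_, fun _ => Iff.rfl⟩
  have hbad := card_bad_le (Bad := P) (c := c) (κ := κ) (N := N) (fun t ht hb => by
      obtain ⟨i, hi, hag, hcc⟩ := hdec ht
      refine ⟨i, lt_of_le_of_ne hi ?_, hcc⟩
      rintro rfl
      exact (hP _).1 hb hag) hmN
  have hbad' := card_bad_le (Bad := P') (c := c') (κ := κ) (N := N) (fun t ht hb => by
      obtain ⟨i, hi, hag, hcc⟩ := hdec' ht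
      refine ⟨i, lt_of_le_of_ne hi ?_, hcc⟩
      rintro rfl
      exact (hP' _).1 hb hag) hmN
  set B := (Finset.range (m + 1)).filter P
  set B' := (Finset.range (m + 1)).filter P'
  set G := (Finset.range m).filter (Synced T a ι g y g' y') with hG
  have hcover : m ≤ G.card + (B.card + B'.card) := by
    have hsub : Finset.range m ⊆ G ∪ (B ∪ B') := by
      intro t ht
      rw [Finset.mem_range] at ht
      simp only [G, B, B', Finset.mem_union, Finset.mem_filter, Finset.mem_range, Synced, hP, hP']
      by_cases h1 : ∀ i < t, decode a ι y' t i = ownStream T a ι g y i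
      · by_cases h2 : ∀ i < t, decode a ι y t i = ownStream T a ι g' y' i
        · exact Or.inl ⟨ht, h2, h1⟩
        · exact Or.inr (Or.inr ⟨by omega, h2⟩)
      · exact Or.inr (Or.inl ⟨by omega, h1⟩)
    have h1 := Finset.card_le_card hsub
    rw [Finset.card_range] at h1
    exact h1.trans ((Finset.card_union_le _ _).trans
      (Nat.add_le_add_left (Finset.card_union_le _ _) _))
  -- Bad times and the tail after `m` are charged to disjoint parts of the noise, and (κ + 1) times
  -- the noise is at most (κ - 1)N.
  have hgood : N ≤ κ * G.card := by
    have hsplit : ∑ i ∈ Finset.range N, (c i + c' i) = ∑ i ∈ Finset.range m, c i +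
        ∑ i ∈ Finset.range m, c' i + ∑ i ∈ Finset.Ico m N, (c i + c' i) := by
      rw [← Finset.sum_range_add_sum_Ico _ hmN, Finset.sum_add_distrib]
    rw [hsplit] at hcost
    have hNm : N = m + (N - m) := by omega
    have h3 : κ * N ≤ κ * (G.card + (B.card + B'.card) + (N - m)) :=
      Nat.mul_le_mul_left _ (by omega)
    simp only [mul_add] at h3 hcost
    omega
  have hfin : Announced (ownStream T a ι g' y') m (truth g' g T).own := by
    rcases Nat.eq_zero_or_pos T with hT | hT
    · rw [hT]
      exact ⟨0, Nat.zero_le _, rfl⟩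
    rcases finished_or_hasCost T a ι g y g' y' m with ⟨-, h⟩ | ⟨d, d', -, -, h⟩
    · exact h
    · exfalso
      rw [← hG, ← hN] at h
      have h1 : W * G.card ≤ 2 * N + 2 * N := by
        have : W * G.card ≤ d + d' + W * G.card := Nat.le_add_left _ _
        omega
      have hGpos : 0 < G.card := by
        rcases Nat.eq_zero_or_pos G.card with h0 | h0
        · rw [h0, mul_zero] at hgood
          have : 0 < N := Nat.mul_pos (by omega) hT
          omega
        · exact h0
      -- Now 4(κ + 1)|G| ≤ 4N ≤ 4κ|G|, impossible for |G| > 0.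
      rw [hW] at h1
      nlinarith
  exact knownView_lookup (ownStream_honest T a ι g' y') hmN
    (fun i hi => hagree' i (lt_of_lt_of_le hi (min_le_right _ _))) hfin

end Simulation

end AdaptiveCoding

/-! ### Noiseless protocols as exchanges -/

namespace NoiselessProtocol

variable {X Y Z : Type*}

/-- The subtree after one simultaneous exchange of the bits `a` of Alice and `b` of Bob, of which
only the bit of the party to speak matters. -/
def child : NoiselessProtocol X Y Z → Bool → Bool → NoiselessProtocol X Y Z
  | leaf outA outB, _, _ => leaf outA outB
  | alice _ t0 t1, a, _ => bif a then t1 else t0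
  | bob _ t0 t1, _, b => bif b then t1 else t0

/-- The bit of Alice in a simultaneous exchange. -/
def bitA (x : X) : NoiselessProtocol X Y Z → Bool
  | alice bit _ _ => bit x
  | _ => false

/-- The bit of Bob in a simultaneous exchange. -/
def bitB (y : Y) : NoiselessProtocol X Y Z → Bool
  | bob bit _ _ => bit y
  | _ => false

/-- The output of Alice at a leaf, and `z` elsewhere. -/
def leafA (z : Z) (x : X) : NoiselessProtocol X Y Z → Z
  | leaf outA _ => outA x
  | _ => z

/-- The output of Bob at a leaf, and `z` elsewhere. -/
def leafB (z : Z) (y : Y) : NoiselessProtocol X Y Z → Z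
  | leaf _ outB => outB y
  | _ => z

theorem outputs_child (P : NoiselessProtocol X Y Z) (x : X) (y : Y) :
    (P.child (P.bitA x) (P.bitB y)).outputs x y = P.outputs x y := by
  cases P with
  | leaf outA outB => rfl
  | alice bit t0 t1 => simp only [child, bitA, outputs]; cases bit x <;> rfl
  | bob bit t0 t1 => simp only [child, bitB, outputs]; cases bit y <;> rfl

theorem depth_child_le (P : NoiselessProtocol X Y Z) (a b : Bool) :
    (P.child a b).depth ≤ P.depth - 1 := by
  cases P with
  | leaf outA outB => exact Nat.zero_le _
  | alice bit t0 t1 => cases a <;> simp [child, depth]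
  | bob bit t0 t1 => cases b <;> simp [child, depth]

theorem leaf_of_depth_eq_zero {P : NoiselessProtocol X Y Z} (h : P.depth = 0) (z : Z) (x : X)
    (y : Y) : (P.leafA z x, P.leafB z y) = P.outputs x y := by
  cases P with
  | leaf outA outB => rfl
  | alice bit t0 t1 => simp [depth] at h
  | bob bit t0 t1 => simp [depth] at h

/-- The subtree reached, from the list of pairs that Alice has seen and the last bit of Bob. -/
def nodeA (P : NoiselessProtocol X Y Z) : List (Bool × Bool) → Bool → NoiselessProtocol X Y Z
  | [], _ => P
  | q :: L, e => (nodeA P L q.1).child q.2 e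

/-- The subtree reached, from the list of pairs that Bob has seen and the last bit of Alice. -/
def nodeB (P : NoiselessProtocol X Y Z) : List (Bool × Bool) → Bool → NoiselessProtocol X Y Z
  | [], _ => P
  | q :: L, e => (nodeB P L q.1).child e q.2

/-- The next bit of Alice. -/
def nextA (P : NoiselessProtocol X Y Z) (x : X) (L : List (Bool × Bool)) (e : Bool) : Bool :=
  (P.nodeA L e).bitA x

/-- The next bit of Bob. -/
def nextB (P : NoiselessProtocol X Y Z) (y : Y) (L : List (Bool × Bool)) (e : Bool) : Bool :=
  (P.nodeB L e).bitB y

open AdaptiveCoding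

/-- A party's list lacks only the other's latest bit. Supplied with it, both lists describe the same
path in the tree. -/
theorem node_truth (P : NoiselessProtocol X Y Z) (x : X) (y : Y) (n : ℕ) :
    P.nodeA (truth (P.nextA x) (P.nextB y) n).own (truth (P.nextA x) (P.nextB y) n).otherBit =
      P.nodeB (truth (P.nextA x) (P.nextB y) n).other (truth (P.nextA x) (P.nextB y) n).ownBit ∧
    (P.nodeA (truth (P.nextA x) (P.nextB y) n).own
      (truth (P.nextA x) (P.nextB y) n).otherBit).outputs x y = P.outputs x y ∧
    (P.nodeA (truth (P.nextA x) (P.nextB y) n).own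
      (truth (P.nextA x) (P.nextB y) n).otherBit).depth ≤ P.depth - n := by
  induction n with
  | zero => exact ⟨rfl, rfl, le_rfl⟩
  | succ n ih =>
    obtain ⟨h1, h2, h3⟩ := ih
    simp only [truth, View.push, nodeA, nodeB]
    refine ⟨by rw [h1], ?_, ?_⟩
    · rw [nextA, nextB, ← h1, outputs_child, h2]
    · have := depth_child_le (P.nodeA (truth (P.nextA x) (P.nextB y) n).own
        (truth (P.nextA x) (P.nextB y) n).otherBit)
        (P.nextA x (truth (P.nextA x) (P.nextB y) n).own
          (truth (P.nextA x) (P.nextB y) n).otherBit)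
        (P.nextB y (truth (P.nextA x) (P.nextB y) n).other
          (truth (P.nextA x) (P.nextB y) n).ownBit)
      omega

theorem leaf_node_truth (P : NoiselessProtocol X Y Z) (x : X) (y : Y) (z : Z) :
    ((P.nodeA (truth (P.nextA x) (P.nextB y) P.depth).own
      (truth (P.nextA x) (P.nextB y) P.depth).otherBit).leafA z x,
     (P.nodeB (truth (P.nextB y) (P.nextA x) P.depth).own
      (truth (P.nextB y) (P.nextA x) P.depth).otherBit).leafB z y) = P.outputs x y := by
  obtain ⟨h1, h2, h3⟩ := P.node_truth x y P.depth
  rw [truth_swap (P.nextA x) (P.nextB y)]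
  simp only [View.swap]
  rw [← h1, leaf_of_depth_eq_zero (by omega), h2]

end NoiselessProtocol

/-! ### Executions as sequences of rounds -/

namespace AdaptiveProtocol

variable {S X Y Z : Type*}

theorem exists_records (π : AdaptiveProtocol S X Y Z) (eve : Adversary S X Y) (x : X) (y : Y) :
    ∃ r : ℕ → RoundRecord S, (∀ n, π.transcriptUpTo eve x y n = (List.range n).map r) ∧
      (∀ n, (r n).sentA = π.sendA x ((List.range n).map fun i => (r i).recvA)) ∧
      ∀ n, (r n).sentB = π.sendB y ((List.range n).map fun i => (r i).recvB) := by
  let h := fun n => π.transcriptUpTo eve x y n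
  let r : ℕ → RoundRecord S := fun n =>
    { sentA := π.sendA x ((h n).map RoundRecord.recvA)
      recvB := eve.chA x y (h n) (π.sendA x ((h n).map RoundRecord.recvA))
      sentB := π.sendB y ((h n).map RoundRecord.recvB)
      recvA := eve.chB x y (h n) (π.sendB y ((h n).map RoundRecord.recvB)) }
  have hr : ∀ n, π.transcriptUpTo eve x y n = (List.range n).map r := by
    intro n
    induction n with
    | zero => rfl
    | succ n ih =>
      rw [List.range_succ, List.map_append, ← ih]
      rfl
  refine ⟨r, hr, fun n => ?_, fun n => ?_⟩
  · change π.sendA x ((π.transcriptUpTo eve x y n).map _) = _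
    rw [hr, List.map_map]
    rfl
  · change π.sendB y ((π.transcriptUpTo eve x y n).map _) = _
    rw [hr, List.map_map]
    rfl

end AdaptiveProtocol

namespace AdaptiveCoding

theorem countP_map_range {α : Type*} (r : ℕ → α) (q : α → Bool) (n : ℕ) :
    ((List.range n).map r).countP q = ∑ i ∈ Finset.range n, if q (r i) then 1 else 0 := by
  induction n with
  | zero => rfl
  | succ n ih =>
    rw [List.range_succ, List.map_append, List.countP_append, ih, Finset.sum_range_succ]
    simp [List.countP_cons]

theorem sum_range_mul_eq (f : ℕ → ℕ) (n p : ℕ) : ∑ i ∈ Finset.range (n * p), f i =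
    ∑ t ∈ Finset.range n, ∑ j ∈ Finset.range p, f (t * p + j) := by
  induction n with
  | zero => simp
  | succ n ih => rw [Nat.succ_mul, Finset.sum_range_add, ih, Finset.sum_range_succ]

/-! ### Pulse position coding -/

section PulsePosition

variable {p : ℕ}

/-- The symbol `s` is sent as a pulse at the position `s`. -/
def pulse (s : ZMod p) (j : ℕ) : Option (Fin 1) := if s.val = j then some 0 else none

open Classical in
/-- The symbol received in the block `t` of `p` rounds: it is erased unless there is exactly one
pulse. -/
noncomputable def symbolAt (ρ : ℕ → Option (Fin 1)) (t : ℕ) : Option (ZMod p) :=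
  if h : ∃ s : ZMod p, ∀ s' : ZMod p, (ρ (t * p + s'.val)).isSome ↔ s' = s then some h.choose
  else none

theorem symbolAt_eq_some {ρ : ℕ → Option (Fin 1)} {t : ℕ} {s : ZMod p} :
    symbolAt ρ t = some s ↔ ∀ s' : ZMod p, (ρ (t * p + s'.val)).isSome ↔ s' = s := by
  unfold symbolAt
  constructor
  · intro h
    split_ifs at h with hs
    rw [Option.some.injEq] at h
    exact h ▸ hs.choose_spec
  · intro h
    have hs : ∃ s : ZMod p, ∀ s' : ZMod p, (ρ (t * p + s'.val)).isSome ↔ s' = s := ⟨s, h⟩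
    rw [dif_pos hs, Option.some.injEq]
    exact ((hs.choose_spec s).1 ((h s).2 rfl)).symm

variable [Fact p.Prime]

theorem symbolAt_congr {ρ ρ' : ℕ → Option (Fin 1)} {t : ℕ}
    (h : ∀ i < (t + 1) * p, ρ i = ρ' i) :
    (symbolAt ρ t : Option (ZMod p)) = symbolAt ρ' t := by
  ext s
  rw [symbolAt_eq_some, symbolAt_eq_some]
  refine forall_congr' fun s' => ?_
  rw [h]
  have := ZMod.val_lt s'
  rw [Nat.succ_mul]
  omega

theorem sum_pulse (s : ZMod p) :
    ∑ j ∈ Finset.range p, (if (pulse s j).isSome then 1 else 0) = 1 := by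
  rw [Finset.sum_eq_single s.val]
  · simp [pulse]
  · intro j _ hj
    simp [pulse, hj.symm]
  · intro h
    exact absurd (Finset.mem_range.2 (ZMod.val_lt s)) h

/-- An intact block is read correctly; reading another symbol requires the pulse at `s` deleted and
one inserted elsewhere. -/
theorem symbolCost_le (ρ : ℕ → Option (Fin 1)) (t : ℕ) (s : ZMod p) :
    symbolCost (symbolAt ρ t) s ≤
      ∑ j ∈ Finset.range p, if ρ (t * p + j) ≠ pulse s j then 1 else 0 := by
  unfold symbolCost
  split_ifs with h1 h2
  · exact Nat.zero_le _
  · by_contra hlt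
    rw [not_le, Nat.lt_one_iff, Finset.sum_eq_zero_iff] at hlt
    refine h1 (symbolAt_eq_some.2 fun s' => ?_)
    have := hlt s'.val (Finset.mem_range.2 (ZMod.val_lt s'))
    simp only [ne_eq, ite_not, ite_eq_left_iff, one_ne_zero, imp_false, not_not] at this
    rw [this, pulse]
    by_cases hs : s' = s
    · simp [hs]
    · have : s.val ≠ s'.val := fun h => hs (ZMod.val_injective p h).symm
      simp [hs, this]
  · obtain ⟨s', hs'⟩ := Option.ne_none_iff_exists'.1 h2
    have hne : s ≠ s' := by
      rintro rfl
      exact h1 hs'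
    have hval : s.val ≠ s'.val := fun h => hne (ZMod.val_injective p h)
    have hpulse := symbolAt_eq_some.1 hs'
    have hsub : ({s.val, s'.val} : Finset ℕ) ⊆ Finset.range p := by
      intro j hj
      simp only [Finset.mem_insert, Finset.mem_singleton] at hj
      rcases hj with rfl | rfl <;> exact Finset.mem_range.2 (ZMod.val_lt _)
    refine le_trans (le_of_eq ?_) (Finset.sum_le_sum_of_subset hsub)
    have e1 : ρ (t * p + s.val) ≠ pulse s s.val := by
      intro h
      exact hne ((hpulse s).1 (by rw [h]; simp [pulse]))
    have e2 : ρ (t * p + s'.val) ≠ pulse s s'.val := by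
      intro h
      have := (hpulse s').2 rfl
      rw [h] at this
      simp [pulse, hval] at this
    rw [Finset.sum_pair hval, if_pos e1, if_pos e2]

end PulsePosition

/-! ### The coded protocol -/

section Protocol

variable {W p : ℕ} [Fact p.Prime] (T : ℕ) (a : ℕ → ZMod p) (ι : Packet W → ZMod p)
  (g : List (Bool × Bool) → Bool → Bool)

/-- The stream of a party that receives `ρ`. -/
noncomputable def streamOf (ρ : ℕ → Option (Fin 1)) : ℕ → Packet W :=
  ownStream T a ι g (symbolAt ρ)

/-- What a party sends in round `n` if it receives `ρ`. -/
noncomputable def sendOf (ρ : ℕ → Option (Fin 1)) (n : ℕ) : Option (Fin 1) :=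
  pulse (encode a ι (streamOf T a ι g ρ) (n / p)) (n % p)

/-- What a party knows about the exchange in the end if it receives `ρ`. -/
noncomputable def resultOf (ρ : ℕ → Option (Fin 1)) : Option View :=
  knownView g (lookup (decode a ι (symbolAt ρ) (W * T)) (W * T)) T

/-- Causality: the packets up to block `n / p` depend only on completed earlier blocks. So the
padding of the received list by silence is harmless. -/
theorem sendOf_congr {ρ ρ' : ℕ → Option (Fin 1)} {n : ℕ} (h : ∀ i < n, ρ i = ρ' i) :
    sendOf T a ι g ρ n = sendOf T a ι g ρ' n := by
  unfold sendOf streamOf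
  rw [encode_congr fun k hk => ownStream_congr T a ι g fun i hi => symbolAt_congr fun j hj => ?_]
  refine h j (hj.trans_le ?_)
  calc (i + 1) * p ≤ n / p * p := Nat.mul_le_mul_right _ (by omega)
    _ ≤ n := Nat.div_mul_le_self n p

theorem resultOf_congr {ρ ρ' : ℕ → Option (Fin 1)} (h : ∀ i < W * T * p, ρ i = ρ' i) :
    resultOf T a ι g ρ = resultOf T a ι g ρ' := by
  unfold resultOf
  rw [decode_congr fun i hi => symbolAt_congr fun j hj => h j (hj.trans_le ?_)]
  exact Nat.mul_le_mul_right _ hi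

variable {X Y Z : Type*} (P : NoiselessProtocol X Y Z) (z : Z)

/-- The coded version of the noiseless protocol `P`. -/
noncomputable def codedProtocol : AdaptiveProtocol (Fin 1) X Y Z where
  rounds := W * P.depth * p
  sendA x l := sendOf P.depth a ι (P.nextA x) (fun i => l.getD i none) l.length
  sendB y l := sendOf P.depth a ι (P.nextB y) (fun i => l.getD i none) l.length
  outA x l := (resultOf P.depth a ι (P.nextA x) fun i => l.getD i none).elim z
    fun v => (P.nodeA v.own v.otherBit).leafA z x
  outB y l := (resultOf P.depth a ι (P.nextB y) fun i => l.getD i none).elim z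
    fun v => (P.nodeB v.own v.otherBit).leafB z y

theorem getD_map_range {α : Type*} (r : ℕ → α) (d : α) {n i : ℕ} (hi : i < n) :
    ((List.range n).map r).getD i d = r i := by
  simp [List.getD, hi]

/-- One pulse per block whatever is received, so the adversary cannot influence the denominator of
the noise rate. -/
theorem sum_sendOf_isSome (ρ : ℕ → Option (Fin 1)) (n : ℕ) :
    ∑ i ∈ Finset.range (n * p), (if (sendOf T a ι g ρ i).isSome then 1 else 0) = n := by
  have hp : 0 < p := (Fact.out : p.Prime).pos
  rw [sum_range_mul_eq]
  calc _ = ∑ t ∈ Finset.range n, 1 := Finset.sum_congr rfl fun t _ => by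
        refine Eq.trans (Finset.sum_congr rfl fun j hj => ?_)
          (sum_pulse (encode a ι (streamOf T a ι g ρ) t))
        rw [Finset.mem_range] at hj
        rw [sendOf, mul_comm t p, Nat.mul_add_div hp, Nat.div_eq_of_lt hj, Nat.mul_add_mod,
          Nat.mod_eq_of_lt hj, add_zero]
    _ = n := by simp

theorem sum_symbolCost_le (ρ ρ' : ℕ → Option (Fin 1)) (n : ℕ) :
    ∑ i ∈ Finset.range n, symbolCost (symbolAt ρ' i) (encode a ι (streamOf T a ι g ρ) i) ≤
      ∑ i ∈ Finset.range (n * p), (if ρ' i ≠ sendOf T a ι g ρ i then 1 else 0) := by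
  have hp : 0 < p := (Fact.out : p.Prime).pos
  rw [sum_range_mul_eq]
  refine Finset.sum_le_sum fun t _ => (symbolCost_le ρ' t _).trans (le_of_eq ?_)
  refine Finset.sum_congr rfl fun j hj => ?_
  rw [Finset.mem_range] at hj
  rw [sendOf, mul_comm t p, Nat.mul_add_div hp, Nat.div_eq_of_lt hj, Nat.mul_add_mod,
    Nat.mod_eq_of_lt hj, add_zero]

/-- The rate 1/2 - 1/(κ + 1) of 2N transmissions allows (κ - 1)N/(κ + 1) corruptions, just what
`knownView_of_cost_le` tolerates. -/
theorem codedProtocol_resists {κ : ℕ} (hκ : 1 ≤ κ) (hW : W = 4 * (κ + 1))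
    (hι : Function.Injective ι) (hcode : IsTreeCode a ι (κ + 1) (W * P.depth))
    {f : X → Y → Z} (hf : P.Computes f) :
    (codedProtocol a ι P z).Resists f (ENNReal.ofReal (1 / 2 - 1 / (κ + 1))) := by
  intro x y eve hrate
  set π := codedProtocol a ι P z with hπ
  obtain ⟨r, hr, hA, hB⟩ := π.exists_records eve x y
  set ρA : ℕ → Option (Fin 1) := fun i => (r i).recvA with hρA
  set ρB : ℕ → Option (Fin 1) := fun i => (r i).recvB with hρB
  have hsA : ∀ n, (r n).sentA = sendOf P.depth a ι (P.nextA x) ρA n := by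
    intro n
    rw [hA]
    change sendOf P.depth a ι (P.nextA x) _ _ = _
    rw [List.length_map, List.length_range]
    exact sendOf_congr _ _ _ _ fun i hi => getD_map_range _ _ hi
  have hsB : ∀ n, (r n).sentB = sendOf P.depth a ι (P.nextB y) ρB n := by
    intro n
    rw [hB]
    change sendOf P.depth a ι (P.nextB y) _ _ = _
    rw [List.length_map, List.length_range]
    exact sendOf_congr _ _ _ _ fun i hi => getD_map_range _ _ hi
  have htr : π.transcript eve x y = (List.range (W * P.depth * p)).map r := hr _
  have hCC : π.instanceCC eve x y = 2 * (W * P.depth) := by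
    rw [AdaptiveProtocol.instanceCC, htr, countP_map_range, countP_map_range]
    simp only [hsA, hsB]
    rw [sum_sendOf_isSome, sum_sendOf_isSome, two_mul]
  have hNC : ∑ i ∈ Finset.range (W * P.depth),
        (symbolCost (symbolAt ρB i) (encode a ι (streamOf P.depth a ι (P.nextA x) ρA) i) +
          symbolCost (symbolAt ρA i) (encode a ι (streamOf P.depth a ι (P.nextB y) ρB) i)) ≤
      π.instanceNC eve x y := by
    rw [AdaptiveProtocol.instanceNC, htr, countP_map_range, countP_map_range,
      Finset.sum_add_distrib]
    simp only [hsA, hsB, decide_eq_true_eq]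
    exact Nat.add_le_add (sum_symbolCost_le _ _ _ _ ρA ρB _) (sum_symbolCost_le _ _ _ _ ρB ρA _)
  have hbound : (κ + 1) * π.instanceNC eve x y + W * P.depth ≤ κ * (W * P.depth) := by
    rw [AdaptiveProtocol.noiseRate, hCC] at hrate
    have h1 := (ENNReal.div_le_iff_le_mul (Or.inr ENNReal.ofReal_ne_top)
      (Or.inl (ENNReal.natCast_ne_top _))).1 hrate
    rw [← ENNReal.ofReal_natCast, ← ENNReal.ofReal_natCast (2 * (W * P.depth)),
      ← ENNReal.ofReal_mul' (Nat.cast_nonneg _)] at h1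
    have hκ' : (1 : ℝ) ≤ κ := by exact_mod_cast hκ
    have hr0 : (0 : ℝ) ≤ 1 / 2 - 1 / (κ + 1) := by
      rw [sub_nonneg]
      exact one_div_le_one_div_of_le two_pos (by linarith)
    rw [ENNReal.ofReal_le_ofReal_iff (by positivity)] at h1
    have h2 := mul_le_mul_of_nonneg_left h1 (show (0 : ℝ) ≤ κ + 1 by linarith)
    have h3 : ((κ : ℝ) + 1) * ((1 / 2 - 1 / (κ + 1)) * ((2 * (W * P.depth) : ℕ) : ℝ)) =
        κ * (W * P.depth) - W * P.depth := by
      push_cast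
      field_simp
      ring
    rw [h3] at h2
    have h4 : ((κ : ℝ) + 1) * (π.instanceNC eve x y : ℝ) + W * P.depth ≤ κ * (W * P.depth) := by
      linarith
    exact_mod_cast h4
  have hcost := (Nat.add_le_add_right (Nat.mul_le_mul_left (κ + 1) hNC) _).trans hbound
  have hleaf := (P.leaf_node_truth x y z).trans (hf x y)
  rw [Prod.mk.injEq] at hleaf
  rw [AdaptiveProtocol.CorrectOn, htr, List.map_map, List.map_map]
  constructor
  · have hA : resultOf P.depth a ι (P.nextA x)
        (fun i => ((List.range (W * P.depth * p)).map (RoundRecord.recvA ∘ r)).getD i none) =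
        some (truth (P.nextA x) (P.nextB y) P.depth) := by
      refine (resultOf_congr _ _ _ _ (ρ' := ρA) fun i hi => getD_map_range _ _ hi).trans ?_
      exact knownView_of_cost_le P.depth a ι (P.nextA x) (symbolAt ρA) (P.nextB y) (symbolAt ρB)
        hW hι hcode hcost
    refine Eq.trans ?_ hleaf.1
    change Option.elim _ _ _ = _
    rw [hA]
    rfl
  · have hB : resultOf P.depth a ι (P.nextB y)
        (fun i => ((List.range (W * P.depth * p)).map (RoundRecord.recvB ∘ r)).getD i none) =
        some (truth (P.nextB y) (P.nextA x) P.depth) := by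
      refine (resultOf_congr _ _ _ _ (ρ' := ρB) fun i hi => getD_map_range _ _ hi).trans ?_
      refine knownView_of_cost_le P.depth a ι (P.nextB y) (symbolAt ρB) (P.nextA x) (symbolAt ρA)
        hW hι hcode ?_
      simp only [add_comm (symbolCost (symbolAt ρA _) _)]
      exact hcost
    refine Eq.trans ?_ hleaf.2
    change Option.elim _ _ _ = _
    rw [hB]
    rfl

end Protocol

/-- For every window and distance there is a prime alphabet with tree codes of all lengths. -/
theorem exists_isTreeCode (W M : ℕ) :
    ∃ p : ℕ, ∃ _ : Fact p.Prime, ∃ ι : Packet W → ZMod p, Function.Injective ι ∧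
      ∀ N, ∃ a : ℕ → ZMod p, IsTreeCode a ι M N := by
  classical
  have := finite_packet W
  have := Fintype.ofFinite (Packet W)
  set β := Fintype.card (Packet W) with hβ
  -- The power serves the tree code, as there are at most β² differences of labels; the summand β
  -- makes room for the labels.
  obtain ⟨p, hp, hprime⟩ := Nat.exists_infinite_primes ((2 * (β * β)) ^ M + β)
  have hfact : Fact p.Prime := ⟨hprime⟩
  have hcard : Fintype.card (Packet W) ≤ Fintype.card (ZMod p) := by
    rw [ZMod.card]; omega
  obtain ⟨ι⟩ := Function.Embedding.nonempty_of_card_le hcard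
  refine ⟨p, hfact, ι, ι.injective, fun N => ?_⟩
  set D : Finset (ZMod p) :=
    (Finset.univ : Finset (Packet W × Packet W)).image fun q => ι q.1 - ι q.2 with hD
  have hDcard : D.card ≤ β * β := by
    refine Finset.card_image_le.trans ?_
    rw [Finset.card_univ, Fintype.card_prod]
  obtain ⟨a, ha⟩ := exists_treeCode D (M := M) (by
    rw [ZMod.card]
    calc (2 * D.card) ^ M ≤ (2 * (β * β)) ^ M := Nat.pow_le_pow_left (by omega) _
      _ ≤ p := by omega) N
  refine ⟨a, fun n hn d hd => ha n hn d fun i => ?_⟩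
  obtain ⟨u, v, huv⟩ := hd i
  exact Finset.mem_image.2 ⟨(u, v), Finset.mem_univ _, huv.symm⟩

end AdaptiveCoding

theorem theorem5 :
    ∀ ε : ℝ, 0 < ε →
      ∃ k C : ℕ,
        ∀ (X : Type*) (Y : Type*) (Z : Type*) [Finite X] [Finite Y] [Finite Z] [Nonempty Z]
          (f : X → Y → Z),
          ∃ π : AdaptiveProtocol (Fin k) X Y Z,
            π.rounds ≤ C * commComplexity f ∧
              π.Resists f (ENNReal.ofReal (1 / 2 - ε)) := by
  intro ε hε
  obtain ⟨n, hn⟩ := exists_nat_one_div_lt hε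
  -- Here κ = n + 1, which is at least 1 and has 1/(κ + 1) < ε. The prime is fixed before `f`; only
  -- the code coefficients depend on the depth.
  obtain ⟨p, hp, ι, hι, hcode⟩ := AdaptiveCoding.exists_isTreeCode (4 * (n + 1 + 1)) (n + 1 + 1)
  refine ⟨1, 4 * (n + 1 + 1) * p, ?_⟩
  intro X Y Z _ _ _ hZ f
  obtain ⟨P, hP, hdepth⟩ : ∃ P : NoiselessProtocol X Y Z, P.Computes f ∧
      P.depth = commComplexity f := by
    obtain ⟨P, hP⟩ := NoiselessProtocol.exists_computes f
    exact Nat.sInf_mem (s := {T | ∃ P : NoiselessProtocol X Y Z, P.Computes f ∧ P.depth = T})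
      ⟨P.depth, P, hP, rfl⟩
  obtain ⟨z⟩ := hZ
  obtain ⟨a, ha⟩ := hcode (4 * (n + 1 + 1) * P.depth)
  refine ⟨AdaptiveCoding.codedProtocol a ι P z, ?_, ?_⟩
  · rw [← hdepth]
    change 4 * (n + 1 + 1) * P.depth * p ≤ _
    exact le_of_eq (by ring)
  · intro x y eve hrate
    refine AdaptiveCoding.codedProtocol_resists a ι P z (Nat.le_add_left 1 n) rfl hι ha hP x y eve
      (hrate.trans (ENNReal.ofReal_le_ofReal ?_))
    have : (1 : ℝ) / (((n + 1 : ℕ) : ℝ) + 1) ≤ 1 / ((n : ℝ) + 1) :=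
      one_div_le_one_div_of_le (by positivity) (by push_cast; linarith)
    linarith
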